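/- Let $\Omega$ be a standard Borel space with a non-atomic probability measure $\mu$. For an abelian group $G$ (written additively) with an invariant metric $d$, let $L(\Omega,G)$ be the group of Borel maps $f:\Omega\to G$ with $\int_\Omega d(f(t),0)\,d\mu(t)<\infty$, modulo equality almost everywhere, with the pointwise group law and the metric $d(f,g)=\int_\Omega d(f(t),g(t))\,d\mu(t)$; the constant maps form a closed subgroup of $L(\Omega,G)$ that is identified with $G$. Quotients of such metric groups by subgroups carry the quotient (pseudo-)metric $d(\bar x,\bar y)=\inf\{d(x,y)\}$, the infimum being over all representatives; it is a metric if the subgroup is closed. Let $\Gamma$ be an abelian group with the discrete metric ($d(x,y)=1$ for $x\neq y$). Put $B_1(\Gamma)=L(\Omega,\Gamma)/\Gamma$ and $B_{n+1}(\Gamma)=L(\Omega,B_n(\Gamma))/B_n(\Gamma)$ for $n\ge 1$. For $n\ge1$ let $\Omega^n$ carry the product measure; for $1\le i\le n$ let $L_{i,n}(\Gamma)\subset L(\Omega^n,\Gamma)$ be the subgroup of classes of Borel functions $f(x_1,\dots,x_n)$ that are independent of $x_i$, and let $L_n(\Gamma)$ be the subgroup of $L(\Omega^n,\Gamma)$ generated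 by $L_{1,n}(\Gamma),\dots,L_{n,n}(\Gamma)$. Then, for every $n\ge 1$, $L_n(\Gamma)$ is a closed subgroup of $L(\Omega^n,\Gamma)$, and there is an isometric group isomorphism $B_n(\Gamma)\simeq L(\Omega^n,\Gamma)/L_n(\Gamma)$. -/

import Mathlib

open MeasureTheory Filter Topology

universe u v

namespace BorelRange

open Set
open scoped ENNReal

theorem exists_cond {A : Set ℝ} (hA : ¬ A.Countable) :
    ∃ p q : ℝ, p ≠ q ∧ (∀ U ∈ 𝓝 p, ¬ (U ∩ A).Countable) ∧ (∀ U ∈ 𝓝 q, ¬ (U ∩ A).Countable) := by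
  let C : Set ℝ := {y | ∀ U ∈ 𝓝 y, ¬ (U ∩ A).Countable}
  have h1 : (A \ C).Countable := by
    let b := TopologicalSpace.countableBasis ℝ
    have hb := TopologicalSpace.isBasis_countableBasis ℝ
    have : A \ C ⊆ ⋃ U ∈ {U ∈ b | (U ∩ A).Countable}, U ∩ A := by
      rintro y ⟨hy, hyC⟩
      simp only [C, mem_ofPred_eq, not_forall, not_not] at hyC
      obtain ⟨U, hU, hc⟩ := hyC
      obtain ⟨V, hV, hyV, hVU⟩ := hb.mem_nhds_iff.1 hU
      simp only [mem_iUnion]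
      exact ⟨V, ⟨hV, hc.mono (inter_subset_inter_left _ hVU)⟩, hyV, hy⟩
    refine Countable.mono this (Countable.biUnion ?_ fun U hU => hU.2)
    exact (TopologicalSpace.countable_countableBasis ℝ).mono fun U hU => hU.1
  have h2 : ¬ C.Subsingleton := by
    intro h
    exact hA ((h1.union h.countable).mono fun x hx => by
      by_cases hxC : x ∈ C
      · exact Or.inr hxC
      · exact Or.inl ⟨hx, hxC⟩)
  rw [not_subsingleton_iff] at h2
  obtain ⟨p, hp, q, hq, hpq⟩ := h2
  exact ⟨p, q, hpq, hp, hq⟩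

theorem exists_small {X : Type*} [PseudoMetricSpace X] [SecondCountableTopology X] {f : X → ℝ}
    {C : Set X} (hC : IsClosed C) (hu : ¬ (f '' C).Countable) {ε : ℝ≥0∞} (hε : 0 < ε) :
    ∃ D ⊆ C, IsClosed D ∧ ¬ (f '' D).Countable ∧ Metric.ediam D ≤ ε := by
  obtain ⟨s, hs, hd⟩ := TopologicalSpace.exists_countable_dense X
  by_contra! hcon
  refine hu ?_
  have hcov : C ⊆ ⋃ x ∈ s, C ∩ Metric.closedEBall x (ε / 2) := by
    intro y hy
    obtain ⟨x, hx, hxy⟩ := EMetric.mem_closure_iff.1 (hd y) (ε / 2) (ENNReal.half_pos hε.ne')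
    exact mem_biUnion hx ⟨hy, hxy.le⟩
  refine Countable.mono (image_mono hcov) ?_
  simp only [image_iUnion]
  refine hs.biUnion fun x _ => ?_
  by_contra hnc
  have h1 := hcon (C ∩ Metric.closedEBall x (ε / 2)) inter_subset_left
    (hC.inter Metric.isClosed_closedEBall) hnc
  have h2 : Metric.ediam (C ∩ Metric.closedEBall x (ε / 2)) ≤ 2 * (ε / 2) :=
    (Metric.ediam_mono inter_subset_right).trans Metric.ediam_closedEBall_le
  rw [ENNReal.mul_div_cancel (by simp) (by simp)] at h2
  exact absurd h1 (not_lt.2 h2)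

theorem exists_split {X : Type*} [PseudoMetricSpace X] [SecondCountableTopology X] {f : X → ℝ}
    (hf : Continuous f) {C : Set X} (hC : IsClosed C ∧ ¬ (f '' C).Countable) {ε : ℝ≥0∞}
    (hε : 0 < ε) :
    ∃ D : Bool → Set X, (∀ b, IsClosed (D b) ∧ ¬ (f '' D b).Countable) ∧
      (∀ b, D b ⊆ C ∧ Metric.ediam (D b) ≤ ε) ∧ Disjoint (f '' D false) (f '' D true) := by
  obtain ⟨p, q, hpq, hp, hq⟩ := exists_cond hC.2
  obtain ⟨U, hU, hUc, V, hV, hVc, hUV⟩ : ∃ U ∈ 𝓝 p, IsClosed U ∧ ∃ V ∈ 𝓝 q, IsClosed V ∧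
      Disjoint U V := by
    have hd : 0 < dist p q / 3 := by have := dist_pos.2 hpq; positivity
    refine ⟨_, Metric.closedBall_mem_nhds p hd, Metric.isClosed_closedBall, _,
      Metric.closedBall_mem_nhds q hd, Metric.isClosed_closedBall,
      Metric.closedBall_disjoint_closedBall (by linarith)⟩
  have key : ∀ W : Set ℝ, IsClosed W → ¬ (W ∩ f '' C).Countable →
      ∃ D : Set X, IsClosed D ∧ ¬ (f '' D).Countable ∧ D ⊆ C ∧ Metric.ediam D ≤ ε ∧
        f '' D ⊆ W := by
    intro W hW hWu
    have h : W ∩ f '' C = f '' (C ∩ f ⁻¹' W) := by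
      rw [image_inter_preimage, inter_comm]
    rw [h] at hWu
    obtain ⟨D, hD, h1, h2, h3⟩ := exists_small (hC.1.inter (hW.preimage hf)) hWu hε
    exact ⟨D, h1, h2, hD.trans inter_subset_left, h3,
      image_subset_iff.2 (hD.trans inter_subset_right)⟩
  obtain ⟨D₀, a1, a2, a3, a4, a5⟩ := key U hUc (hp U hU)
  obtain ⟨D₁, b1, b2, b3, b4, b5⟩ := key V hVc (hq V hV)
  exact ⟨fun b => bif b then D₁ else D₀, by rintro (_ | _) <;> constructor <;> assumption,
    by rintro (_ | _) <;> constructor <;> assumption, hUV.mono a5 b5⟩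

open CantorScheme in
theorem exists_cantor {X : Type*} [TopologicalSpace X] [PolishSpace X] {f : X → ℝ}
    (hf : Continuous f) (hu : ¬ (range f).Countable) :
    ∃ h : (ℕ → Bool) → X, Function.Injective (f ∘ h) := by
  let := TopologicalSpace.upgradeIsCompletelyMetrizable X
  obtain ⟨u, -, upos', hlim⟩ := exists_seq_strictAnti_tendsto' (zero_lt_one' ℝ≥0∞)
  have upos := fun n => (upos' n).1
  let P := {E : Set X // IsClosed E ∧ ¬ (f '' E).Countable}
  choose S hS1 hS2 hS3 using
    fun (E : P) (n : ℕ) => exists_split hf E.2 (upos n)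
  let DP : List Bool → P := fun l => l.rec ⟨univ, isClosed_univ, by rwa [image_univ]⟩
    fun a l E => ⟨S E (l.length + 1) a, hS1 _ _ a⟩
  let D : List Bool → Set X := fun l => (DP l).1
  have hanti : ClosureAntitone D :=
    Antitone.closureAntitone (fun l a => (hS2 (DP l) (l.length + 1) a).1) fun l => (DP l).2.1
  have hdiam : VanishingDiam D := by
    intro x
    refine tendsto_of_tendsto_of_tendsto_of_le_of_le' tendsto_const_nhds hlim (by simp) ?_
    rw [eventually_atTop]
    refine ⟨1, fun m hm => ?_⟩
    obtain ⟨n, rfl⟩ := Nat.exists_eq_succ_of_ne_zero (Nat.one_le_iff_ne_zero.1 hm)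
    have h : Metric.ediam (D (x n :: PiNat.res x n)) ≤ u ((PiNat.res x n).length + 1) :=
      (hS2 (DP (PiNat.res x n)) ((PiNat.res x n).length + 1) (x n)).2
    rwa [PiNat.res_length] at h
  have hne : ∀ l, (D l).Nonempty := fun l => by
    by_contra h
    rw [not_nonempty_iff_eq_empty] at h
    exact (DP l).2.2 (by change (f '' D l).Countable; simp [h])
  have hdisj : ∀ l, Disjoint (f '' D (false :: l)) (f '' D (true :: l)) := fun l =>
    hS3 (DP l) (l.length + 1)
  have hdom : ∀ x : ℕ → Bool, x ∈ (inducedMap D).1 := fun x => by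
    rw [hanti.map_of_vanishingDiam hdiam hne]
    exact mem_univ x
  refine ⟨fun x => (inducedMap D).2 ⟨x, hdom x⟩, fun x y hxy => ?_⟩
  have hx : ∀ n, f ((inducedMap D).2 ⟨x, hdom x⟩) ∈ f '' D (PiNat.res x n) := fun n =>
    mem_image_of_mem f (map_mem ⟨x, hdom x⟩ n)
  have hy : ∀ n, f ((inducedMap D).2 ⟨x, hdom x⟩) ∈ f '' D (PiNat.res y n) := fun n => by
    have : f ((inducedMap D).2 ⟨x, hdom x⟩) = f ((inducedMap D).2 ⟨y, hdom y⟩) := hxy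
    rw [this]
    exact mem_image_of_mem f (map_mem ⟨y, hdom y⟩ n)
  apply PiNat.res_injective
  funext n
  induction n with
  | zero => rfl
  | succ n ih =>
    have h1 := hx (n + 1)
    have h2 := hy (n + 1)
    rw [PiNat.res_succ] at h1 h2 ⊢
    rw [PiNat.res_succ, ih]
    rw [ih] at h1
    congr 1
    have hd := disjoint_left.1 (hdisj (PiNat.res y n))
    generalize x n = a at h1
    generalize y n = b at h2
    cases a <;> cases b
    · rfl
    · exact (hd h1 h2).elim
    · exact (hd h2 h1).elim
    · rfl

open Cardinal in
theorem countable_range_of_all {X : Type u} [MeasurableSpace X] [StandardBorelSpace X] {f : X → ℝ}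
    (hf : ∀ A : Set ℝ, MeasurableSet (f ⁻¹' A)) : (range f).Countable := by
  by_contra hu
  have hfm : Measurable f := fun A _ => hf A
  obtain ⟨h, hh⟩ : ∃ h : (ℕ → Bool) → X, Function.Injective (f ∘ h) := by
    let := upgradeStandardBorel X
    obtain ⟨t, -, hc, hp⟩ := hfm.exists_continuous
    exact @exists_cantor X t hp f hc hu
  let F : Set (ℕ → Bool) → {s : Set X // MeasurableSet s} := fun A =>
    ⟨f ⁻¹' ((f ∘ h) '' A), hf _⟩
  have hF : Function.Injective F := by
    intro A B hAB
    have h1 : f ⁻¹' ((f ∘ h) '' A) = f ⁻¹' ((f ∘ h) '' B) := congrArg Subtype.val hAB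
    have h2 : ∀ A : Set (ℕ → Bool), h ⁻¹' (f ⁻¹' ((f ∘ h) '' A)) = A := fun A => by
      rw [← preimage_comp]; exact hh.preimage_image A
    rw [← h2 A, h1, h2]
  have hle : #{s : Set X // MeasurableSet s} ≤ 𝔠 := by
    have hg := MeasurableSpace.generateFrom_countableGeneratingSet (α := X)
    have := MeasurableSpace.cardinal_measurableSet_le_continuum
      (s := MeasurableSpace.countableGeneratingSet X)
      ((MeasurableSpace.countable_countableGeneratingSet.le_aleph0).trans aleph0_le_continuum)
    rwa [hg] at this
  have := Cardinal.lift_mk_le_lift_mk_of_injective hF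
  have h3 := this.trans (lift_le_continuum.2 hle)
  rw [Cardinal.mk_set] at h3
  have h4 : #(ℕ → Bool) = 𝔠 := by simp
  rw [h4] at h3
  have h5 : Cardinal.lift.{u, 0} (2 ^ 𝔠) ≤ Cardinal.lift.{u, 0} 𝔠 := h3.trans (by simp)
  exact absurd (Cardinal.cantor 𝔠) (not_lt.2 (Cardinal.lift_le.1 h5))

/-- A Borel map from a standard Borel space to a metric space is automatically strongly measurable
(it has separable range), so that the classes of (almost everywhere) strongly measurable maps used
below are exactly the classes of Borel maps. -/
theorem stronglyMeasurable_of_borel {X : Type u} [MeasurableSpace X] [StandardBorelSpace X]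
    {E : Type v} [PseudoMetricSpace E] [MeasurableSpace E] [BorelSpace E] {f : X → E}
    (hf : Measurable f) : StronglyMeasurable f := by
  refine stronglyMeasurable_iff_measurable_separable.2 ⟨hf, ?_⟩
  obtain ⟨t, -, ht, htd⟩ : ∃ t ⊆ range f, t.Countable ∧ range f ⊆ closure t := by
    refine EMetric.subset_countable_closure_of_almost_dense_set _ fun ε hε => ?_
    obtain ⟨δ, hδ, hδε⟩ := ENNReal.lt_iff_exists_nnreal_btwn.1 hε
    obtain ⟨S, hS⟩ := zorn_subset {N : Set E | N ⊆ range f ∧ Metric.IsSeparated δ N} (by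
      refine fun c hc hch => ⟨⋃₀ c, ⟨sUnion_subset fun N hN => (hc hN).1, ?_⟩,
        fun N hN => subset_sUnion_of_mem hN⟩
      exact (pairwise_sUnion hch.directedOn).2 fun N hN => (hc hN).2)
    have hcov := Metric.isCover_iff_subset_iUnion_closedEBall.1
      (Metric.IsCover.of_maximal_isSeparated hS)
    refine ⟨S, ?_, hcov.trans (iUnion₂_mono fun x _ => Metric.closedEBall_subset_closedEBall hδε.le)⟩
    have hSr : S ⊆ range f := hS.prop.1
    have hSs : Metric.IsSeparated δ S := hS.prop.2
    choose j hj using hSr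
    have hδ2 : (0 : ENNReal) < δ / 2 := ENNReal.half_pos hδ.ne'
    have huniq : ∀ x, ∀ s ∈ S, ∀ s' ∈ S, edist (f x) s < δ / 2 → edist (f x) s' < δ / 2 →
        s = s' := by
      intro x s hs s' hs' h h'
      by_contra hne
      have h1 : (δ : ENNReal) < edist s s' := hSs hs hs' hne
      have h2 := (edist_triangle_left s s' (f x)).trans_lt (ENNReal.add_lt_add h h')
      rw [ENNReal.add_halves] at h2
      exact lt_asymm h1 h2
    let e := embeddingReal X
    have he : Function.Injective e := (measurableEmbedding_embeddingReal X).injective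
    classical
    let g : X → ℝ := fun x => if h : ∃ s, ∃ hs : s ∈ S, edist (f x) s < δ / 2
      then e (j h.choose_spec.choose) else 0
    have hg : ∀ x s (hs : s ∈ S), edist (f x) s < δ / 2 → g x = e (j hs) := by
      intro x s hs h
      have hex : ∃ s, ∃ hs : s ∈ S, edist (f x) s < δ / 2 := ⟨s, hs, h⟩
      have h1 : s = hex.choose := huniq x s hs _ hex.choose_spec.choose h hex.choose_spec.choose_spec
      simp only [g, dif_pos hex]
      congr 2
      exact h1.symm
    have hopen : ∀ T : Set E, MeasurableSet (f ⁻¹' (⋃ s ∈ T, Metric.eball s (δ / 2))) := fun T =>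
      hf (isOpen_biUnion fun s _ => Metric.isOpen_eball).measurableSet
    have hgm : ∀ A : Set ℝ, MeasurableSet (g ⁻¹' A) := by
      intro A
      have : g ⁻¹' A =
          f ⁻¹' (⋃ s ∈ {s | ∃ hs : s ∈ S, e (j hs) ∈ A}, Metric.eball s (δ / 2)) ∪
          ((f ⁻¹' (⋃ s ∈ S, Metric.eball s (δ / 2)))ᶜ ∩ {_x | (0 : ℝ) ∈ A}) := by
        ext x
        by_cases h : ∃ s, ∃ hs : s ∈ S, edist (f x) s < δ / 2
        · obtain ⟨s, hs, hx⟩ := h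
          simp only [mem_preimage, hg x s hs hx, mem_union, mem_iUnion, mem_inter_iff,
            mem_compl_iff, Metric.mem_eball, mem_ofPred_eq]
          constructor
          · exact fun h => Or.inl ⟨s, ⟨hs, h⟩, hx⟩
          · rintro (⟨s', ⟨hs', h⟩, hx'⟩ | ⟨h, -⟩)
            · obtain rfl := huniq x s hs s' hs' hx hx'
              exact h
            · exact (h ⟨s, hs, hx⟩).elim
        · have h0 : g x = 0 := dif_neg h
          simp only [mem_preimage, h0, mem_union, mem_iUnion, mem_inter_iff,
            mem_compl_iff, Metric.mem_eball, mem_ofPred_eq]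
          constructor
          · exact fun h' => Or.inr ⟨fun ⟨s, hs, hx⟩ => h ⟨s, hs, hx⟩, h'⟩
          · rintro (⟨s', ⟨hs', -⟩, hx'⟩ | ⟨-, h'⟩)
            · exact (h ⟨s', hs', hx'⟩).elim
            · exact h'
      rw [this]
      exact (hopen _).union ((hopen _).compl.inter (MeasurableSet.const _))
    have hcount := countable_range_of_all hgm
    have hmaps : MapsTo (fun s => if h : s ∈ S then e (j h) else 0) S (range g) := by
      intro s hs
      refine ⟨j hs, ?_⟩
      simp only [dif_pos hs]
      exact hg _ s hs (by rw [hj hs, edist_self]; exact hδ2)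
    refine hmaps.countable_of_injOn (fun s hs s' hs' h => ?_) hcount
    simp only [dif_pos hs, dif_pos hs'] at h
    rw [← hj hs, ← hj hs', he h]
  exact ⟨t, ht, htd⟩

end BorelRange

/-- `L(Ω, G)`, for an abelian metric group `G` (written additively; its invariant metric is
`d(x, y) = ‖x - y‖`): the Borel maps `f : Ω → G` such that `∫ d(f, 0) < ∞`, modulo equality almost
everywhere, with the distance `d(f, g) = ∫ d(f(t), g(t)) dt` and the pointwise group law.
On a standard Borel space, Borel and strongly measurable maps agree
(`BorelRange.stronglyMeasurable_of_borel`). -/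
abbrev RandomL {Ω : Type v} [MeasurableSpace Ω] (μ : Measure Ω) (G : Type u)
    [NormedAddCommGroup G] : Type (max u v) :=
  Lp G 1 μ

section Constants

variable {Ω : Type v} [MeasurableSpace Ω] (μ : Measure Ω) [IsProbabilityMeasure μ]
variable (G : Type u) [NormedAddCommGroup G]

/-- The copy of `G` inside `L(Ω, G)`: the subgroup of (classes of) constant maps. -/
def constSubgroup : AddSubgroup (RandomL μ G) :=
  (Lp.const 1 μ : G →+ Lp G 1 μ).range

instance isClosed_constSubgroup : IsClosed (constSubgroup μ G : Set (RandomL μ G)) := by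
  rw [← isSeqClosed_iff_isClosed]
  intro u f hu hf
  have h1 : TendstoInMeasure μ (fun n => (u n : Ω → G)) atTop f :=
    tendstoInMeasure_of_tendsto_Lp hf
  obtain ⟨ns, -, hns⟩ := h1.exists_seq_tendsto_ae
  choose a ha using hu
  have h2 : ∀ᵐ t ∂μ, ∀ n, (u n : Ω → G) t = a n := by
    rw [ae_all_iff]
    intro n
    rw [← ha n]
    filter_upwards [Lp.coeFn_const 1 μ (a n)] with t ht
    simp
  have h3 : ∀ᵐ t ∂μ, Tendsto (fun i => a (ns i)) atTop (𝓝 ((f : Ω → G) t)) := by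
    filter_upwards [hns, h2] with t h h'
    simpa only [h'] using h
  obtain ⟨t₀, ht₀⟩ := h3.exists
  refine ⟨(f : Ω → G) t₀, ?_⟩
  refine Lp.ext ?_
  filter_upwards [Lp.coeFn_const 1 μ ((f : Ω → G) t₀), h3] with t ht h
  rw [ht]
  exact tendsto_nhds_unique ht₀ h

/-- The quotient `L(Ω, G) / G`, a metric group for the quotient metric
`d(x̄, ȳ) = inf {d(x, y)}` over the representatives. -/
abbrev ClassifyingQuotient : Type (max u v) :=
  RandomL μ G ⧸ constSubgroup μ G

end Constants

/-- Abelian groups with an invariant metric, bundled. -/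
structure MetricAb : Type (u + 1) where
  carrier : Type u
  [normed : NormedAddCommGroup carrier]

attribute [instance] MetricAb.normed

/-- `B_0(Γ) = Γ`, `B_1(Γ) = L(Ω, Γ) / Γ`, `B_{n+1}(Γ) = L(Ω, B_n(Γ)) / B_n(Γ)`. -/
noncomputable def iteratedB {Ω : Type v} [MeasurableSpace Ω] (μ : Measure Ω)
    [IsProbabilityMeasure μ] (Γ : Type u) [NormedAddCommGroup Γ] : ℕ → MetricAb.{max u v}
  | 0 => ⟨ULift.{v} Γ⟩
  | 1 => ⟨ClassifyingQuotient μ Γ⟩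
  | n + 2 => ⟨ClassifyingQuotient μ (iteratedB μ Γ (n + 1)).carrier⟩

section Power

variable {Ω : Type v} [MeasurableSpace Ω] (μ : Measure Ω)
variable (Γ : Type u) [NormedAddCommGroup Γ] (n : ℕ)

/-- `L(Ωⁿ, Γ)`, where `Ωⁿ` carries the product measure. -/
abbrev RandomLPow : Type (max u v) :=
  RandomL (Measure.pi fun _ : Fin n => μ) Γ

/-- `L_{i,n}(Γ)`: the classes in `L(Ωⁿ, Γ)` of the Borel functions that are independent of the
`i`-th coordinate. -/
noncomputable def indepSubgroup (i : Fin n) : AddSubgroup (RandomLPow μ Γ n) where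
  carrier := {f | ∃ g : (Fin n → Ω) → Γ, StronglyMeasurable g ∧
    (∀ x y : Fin n → Ω, (∀ j, j ≠ i → x j = y j) → g x = g y) ∧
    (f : (Fin n → Ω) → Γ) =ᵐ[Measure.pi fun _ : Fin n => μ] g}
  zero_mem' := ⟨0, stronglyMeasurable_zero, fun _ _ _ => rfl, Lp.coeFn_zero _ _ _⟩
  add_mem' := by
    rintro f₁ f₂ ⟨g₁, hm₁, hi₁, h₁⟩ ⟨g₂, hm₂, hi₂, h₂⟩
    refine ⟨g₁ + g₂, hm₁.add hm₂, fun x y h => ?_, (Lp.coeFn_add f₁ f₂).trans (h₁.add h₂)⟩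
    simp only [Pi.add_apply, hi₁ x y h, hi₂ x y h]
  neg_mem' := by
    rintro f ⟨g, hm, hi, h⟩
    refine ⟨-g, hm.neg, fun x y h' => ?_, (Lp.coeFn_neg f).trans h.neg⟩
    simp only [Pi.neg_apply, hi x y h']

/-- `L_n(Γ)`: the subgroup of `L(Ωⁿ, Γ)` generated by `L_{1,n}(Γ), …, L_{n,n}(Γ)`. -/
noncomputable def indepSum : AddSubgroup (RandomLPow μ Γ n) :=
  ⨆ i : Fin n, indepSubgroup μ Γ n i

end Power

/-! By induction on `n`, there is a metric quotient map `q` from `L(Ωⁿ, Γ)` onto `B_n` with kernel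
`L_n`: it does not increase norms, and for every `C > 1` each `b` has a lift of norm at most `C‖b‖`.
Such a map induces an isometry from its target onto the quotient by its kernel, and the kernel is
closed by continuity.

For the step, view `L(Ωⁿ⁺¹, Γ)` as `L(Ω × Ωⁿ, Γ)`, apply `q` to the sections `F(t, ·)` to land in
`L(Ω, B_n)`, and divide by the constants. Metric quotients compose, so the norm side rests on
`fiberMap_surjectiveOnWith`: lift simple functions value by value, then pass to the closure using
completeness.

The kernel consists of the `F` for which `q(F(t, ·))` is a.e. a constant `b`. Subtracting a lift of
`b`, which does not involve `t`, leaves sections in `L_n`. To decompose `F` without choosing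
decompositions measurably in `t`, `mem_indepSum_of_sectionLp_mem` uses alternating sums over cubes:
they vanish a.e. on `L_n`, and freezing one generic vertex `y` expresses `F(t, x)` through terms in
which some coordinate of `x` has been replaced by that of `y`.

Discreteness of `Γ` enters only through the bound `‖x‖ ≤ 1` and completeness. -/

/-! ### Measurability of currying. -/

section Curry

variable {α β E : Type*} [MeasurableSpace α] [MeasurableSpace β] [NormedAddCommGroup E]

theorem memLp_one_of_norm_le_one (hE : ∀ x : E, ‖x‖ ≤ 1) {μ : Measure α} [IsFiniteMeasure μ]
    {f : α → E} (hf : AEStronglyMeasurable f μ) : MemLp f 1 μ :=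
  MemLp.of_bound hf 1 (Eventually.of_forall fun x => hE (f x))

/-- The section `F(t, ·)` of a strongly measurable map on a product, as an element of `L¹`. -/
noncomputable def sectionLp (hE : ∀ x : E, ‖x‖ ≤ 1) (ν : Measure β) [IsFiniteMeasure ν]
    {F : α × β → E} (hF : StronglyMeasurable F) (t : α) : Lp E 1 ν :=
  (memLp_one_of_norm_le_one hE
    (hF.comp_measurable (measurable_prodMk_left (x := t))).aestronglyMeasurable).toLp
    (fun x => F (t, x))

variable (hE : ∀ x : E, ‖x‖ ≤ 1) (ν : Measure β) [IsFiniteMeasure ν]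

theorem coeFn_sectionLp {F : α × β → E} (hF : StronglyMeasurable F) (t : α) :
    sectionLp hE ν hF t =ᵐ[ν] fun x => F (t, x) :=
  MemLp.coeFn_toLp _

theorem sectionLp_add {F G : α × β → E} (hF : StronglyMeasurable F) (hG : StronglyMeasurable G) :
    sectionLp hE ν (hF.add hG) = sectionLp hE ν hF + sectionLp hE ν hG := rfl

theorem sectionLp_sub {F G : α × β → E} (hF : StronglyMeasurable F) (hG : StronglyMeasurable G) :
    sectionLp hE ν (hF.sub hG) = sectionLp hE ν hF - sectionLp hE ν hG := rfl

theorem enorm_sectionLp {F : α × β → E} (hF : StronglyMeasurable F) (t : α) :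
    ‖sectionLp hE ν hF t‖ₑ = ∫⁻ x, ‖F (t, x)‖ₑ ∂ν := by
  rw [sectionLp, Lp.enorm_toLp, eLpNorm_one_eq_lintegral_enorm]

theorem sectionLp_ae_eq {μ : Measure α} {F G : α × β → E} (hF : StronglyMeasurable F)
    (hG : StronglyMeasurable G) (h : F =ᵐ[μ.prod ν] G) :
    sectionLp hE ν hF =ᵐ[μ] sectionLp hE ν hG := by
  filter_upwards [Measure.ae_ae_of_ae_prod h] with t ht
  exact Lp.ext <| by
    filter_upwards [ht, coeFn_sectionLp hE ν hF t, coeFn_sectionLp hE ν hG t] with x h h₁ h₂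
    rw [h₁, h₂, h]

/-- Dominated convergence on each section; the uniform norm bound on `E` supplies the dominating
constant 1. -/
theorem tendsto_sectionLp {F : ℕ → α × β → E} {G : α × β → E} (hF : ∀ k, StronglyMeasurable (F k))
    (hG : StronglyMeasurable G) (h : ∀ z, Tendsto (fun k => F k z) atTop (𝓝 (G z))) (t : α) :
    Tendsto (fun k => sectionLp hE ν (hF k) t) atTop (𝓝 (sectionLp hE ν hG t)) := by
  refine (Lp.tendsto_Lp_iff_tendsto_eLpNorm'' _ _ _ _).2 ?_
  simp only [eLpNorm_one_eq_lintegral_enorm]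
  have := tendsto_lintegral_of_dominated_convergence (μ := ν)
    (F := fun k x => ‖F k (t, x) - G (t, x)‖ₑ) (f := fun _ => 0) (fun _ => 1)
    (fun k => (((hF k).sub hG).comp_measurable measurable_prodMk_left).enorm)
    (fun k => Eventually.of_forall fun x => by
      simpa using! enorm_le_iff_norm_le.2 ((hE (F k (t, x) - G (t, x))).trans_eq
        (norm_one (α := ℝ)).symm))
    (by simp)
    (Eventually.of_forall fun x => by
      have h1 := ((h (t, x)).sub_const (G (t, x))).enorm
      simpa using h1)
  simpa using this

theorem stronglyMeasurable_sectionLp_limit {F : ℕ → α × β → E} {G : α × β → E}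
    (hF : ∀ k, StronglyMeasurable (F k)) (hG : StronglyMeasurable G)
    (h : ∀ z, Tendsto (fun k => F k z) atTop (𝓝 (G z)))
    (hs : ∀ k, StronglyMeasurable (sectionLp hE ν (hF k))) :
    StronglyMeasurable (sectionLp hE ν hG) :=
  stronglyMeasurable_of_tendsto atTop hs
    (tendsto_pi_nhds.2 (tendsto_sectionLp hE ν hF hG h))

/-- A π-λ argument: a rectangle `A ×ˢ B` curries to a single class switched on by `A`, complements
are differences, and disjoint unions are pointwise limits of partial sums. -/
theorem stronglyMeasurable_sectionLp_indicator (c : E) {s : Set (α × β)} (hs : MeasurableSet s) :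
    StronglyMeasurable (sectionLp hE ν (stronglyMeasurable_const (b := c) |>.indicator hs)) := by
  have hc : ∀ c : E, StronglyMeasurable
      (sectionLp (α := α) hE ν (F := fun _ => c) stronglyMeasurable_const) := fun c =>
    stronglyMeasurable_const (b := (memLp_one_of_norm_le_one hE
      (aestronglyMeasurable_const (μ := ν) (b := c))).toLp _)
  induction s, hs using MeasurableSpace.induction_on_inter generateFrom_prod.symm isPiSystem_prod with
  | empty =>
    convert hc 0 using 2
    simp
  | basic t ht =>
    obtain ⟨A, hA, B, hB, rfl⟩ := ht
    have h := (stronglyMeasurable_const (α := α) (b := (memLp_one_of_norm_le_one hE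
      ((stronglyMeasurable_const (b := c)).indicator hB).aestronglyMeasurable (μ := ν)).toLp
        (B.indicator fun _ => c))).indicator hA
    convert h using 1
    funext t
    by_cases ht : t ∈ A
    · rw [Set.indicator_of_mem ht]
      refine MemLp.toLp_congr _ _ (Eventually.of_forall fun x => ?_)
      by_cases hx : x ∈ B <;> simp [ht, hx]
    · rw [Set.indicator_of_notMem ht]
      refine (Lp.eq_zero_iff_ae_eq_zero).2 ((coeFn_sectionLp hE ν _ t).trans ?_)
      exact Eventually.of_forall fun x => Set.indicator_of_notMem (by simp [ht]) _
  | compl t ht ih =>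
    have h := (hc c).sub ih
    rw [← sectionLp_sub] at h
    convert h using 2
    exact Set.indicator_compl _ _
  | iUnion f hd hf ih =>
    have hF : ∀ k : ℕ, StronglyMeasurable
        (∑ i ∈ Finset.range k, (f i).indicator fun _ => c) := fun k =>
      Finset.stronglyMeasurable_sum _ fun i _ => stronglyMeasurable_const.indicator (hf i)
    refine stronglyMeasurable_sectionLp_limit hE ν hF _ (fun z => ?_) fun k => ?_
    · by_cases hz : z ∈ ⋃ i, f i
      · obtain ⟨i, hi⟩ := Set.mem_iUnion.1 hz
        refine tendsto_atTop_of_eventually_const (i₀ := i + 1) fun k hk => ?_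
        rw [Set.indicator_of_mem hz, Finset.sum_apply,
          Finset.sum_eq_single i, Set.indicator_of_mem hi]
        · intro j _ hj
          exact Set.indicator_of_notMem (fun h => Set.disjoint_left.1 (hd hj) h hi) _
        · intro h
          exact (h (Finset.mem_range.2 hk)).elim
      · refine tendsto_atTop_of_eventually_const (i₀ := 0) fun k _ => ?_
        rw [Set.indicator_of_notMem hz, Finset.sum_apply]
        exact Finset.sum_eq_zero fun j _ =>
          Set.indicator_of_notMem (fun h => hz (Set.mem_iUnion.2 ⟨j, h⟩)) _
    · induction k with
      | zero => exact hc 0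
      | succ k ihk =>
        have h := ihk.add (ih k)
        rw [← sectionLp_add] at h
        convert h using 2
        exact Finset.sum_range_succ _ _

/-- Currying: the sections of a strongly measurable map form a strongly measurable map. -/
theorem stronglyMeasurable_sectionLp {F : α × β → E} (hF : StronglyMeasurable F) :
    StronglyMeasurable (sectionLp hE ν hF) := by
  refine stronglyMeasurable_sectionLp_limit hE ν (fun k => (hF.approx k).stronglyMeasurable) hF
    hF.tendsto_approx fun k => ?_
  induction hF.approx k using SimpleFunc.induction with
  | const c hs =>
    convert stronglyMeasurable_sectionLp_indicator hE ν c hs using 2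
    ext z
    simp only [SimpleFunc.coe_piecewise, SimpleFunc.coe_const, Set.piecewise, Set.indicator,
      Function.const_apply]
  | add _ hf hg => exact hf.add hg

/-! ### Applying a homomorphism to the sections. -/

section FiberMap

variable {B : Type*} [NormedAddCommGroup B] (μ : Measure α) {ν}
variable (q : NormedAddGroupHom (Lp E 1 ν) B)

theorem lintegral_enorm_comp_sectionLp_le (hq : ∀ f, ‖q f‖ ≤ ‖f‖) {F : α × β → E}
    (hF : StronglyMeasurable F) :
    ∫⁻ t, ‖q (sectionLp hE ν hF t)‖ₑ ∂μ ≤ ∫⁻ z, ‖F z‖ₑ ∂μ.prod ν := by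
  rw [lintegral_prod _ hF.enorm.aemeasurable]
  refine lintegral_mono fun t => ?_
  rw [← enorm_sectionLp hE ν hF t]
  exact enorm_le_iff_norm_le.2 (hq _)

variable [IsFiniteMeasure μ]

theorem memLp_comp_sectionLp (hq : ∀ f, ‖q f‖ ≤ ‖f‖) {F : α × β → E} (hF : StronglyMeasurable F) :
    MemLp (fun t => q (sectionLp hE ν hF t)) 1 μ := by
  refine ⟨(q.continuous.comp_stronglyMeasurable
    (stronglyMeasurable_sectionLp hE ν hF)).aestronglyMeasurable, ?_⟩
  rw [eLpNorm_one_eq_lintegral_enorm]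
  refine (lintegral_enorm_comp_sectionLp_le hE μ q hq hF).trans_lt ?_
  rw [← eLpNorm_one_eq_lintegral_enorm]
  exact (memLp_one_of_norm_le_one hE hF.aestronglyMeasurable).2

variable (hq : ∀ f, ‖q f‖ ≤ ‖f‖)

/-- Apply `q` to the sections of an integrable map on a product. -/
noncomputable def fiberMap : NormedAddGroupHom (Lp E 1 (μ.prod ν)) (Lp B 1 μ) :=
  AddMonoidHom.mkNormedAddGroupHom
    (AddMonoidHom.mk' (fun F => (memLp_comp_sectionLp hE μ q hq (Lp.stronglyMeasurable F)).toLp _)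
      fun F G => by
        rw [← MemLp.toLp_add]
        refine MemLp.toLp_congr _ _ ?_
        filter_upwards [sectionLp_ae_eq hE ν (Lp.stronglyMeasurable (F + G))
          ((Lp.stronglyMeasurable F).add (Lp.stronglyMeasurable G)) (Lp.coeFn_add F G)] with t ht
        rw [ht, sectionLp_add, Pi.add_apply, map_add, Pi.add_apply])
    1 fun F => by
      rw [one_mul]
      refine enorm_le_iff_norm_le.1 ?_
      refine (Lp.enorm_toLp (memLp_comp_sectionLp hE μ q hq (Lp.stronglyMeasurable F))).trans_le ?_
      rw [Lp.enorm_def, eLpNorm_one_eq_lintegral_enorm, eLpNorm_one_eq_lintegral_enorm]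
      exact lintegral_enorm_comp_sectionLp_le hE μ q hq (Lp.stronglyMeasurable F)

theorem coeFn_fiberMap (f : Lp E 1 (μ.prod ν)) {F : α × β → E} (hF : StronglyMeasurable F)
    (h : f =ᵐ[μ.prod ν] F) :
    fiberMap hE μ q hq f =ᵐ[μ] fun t => q (sectionLp hE ν hF t) := by
  refine (MemLp.coeFn_toLp (memLp_comp_sectionLp hE μ q hq (Lp.stronglyMeasurable f))).trans ?_
  filter_upwards [sectionLp_ae_eq hE ν (Lp.stronglyMeasurable f) hF h] with t ht
  rw [ht]

theorem norm_fiberMap_le (f : Lp E 1 (μ.prod ν)) : ‖fiberMap hE μ q hq f‖ ≤ ‖f‖ :=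
  ((fiberMap hE μ q hq).le_of_opNorm_le
    (AddMonoidHom.mkNormedAddGroupHom_norm_le _ zero_le_one _) f).trans_eq (one_mul _)

/-- A simple function has finitely many values, so gluing one lift per value is measurable, and
Tonelli integrates the pointwise bound. -/
theorem fiberMap_surjectiveOnWith_simpleFunc {C : ℝ} (hC0 : 0 ≤ C)
    (hC : q.SurjectiveOnWith ⊤ C) :
    (fiberMap hE μ q hq).SurjectiveOnWith (Lp.simpleFunc B 1 μ) C := by
  intro h hh
  let s := Lp.simpleFunc.toSimpleFunc (⟨h, hh⟩ : Lp.simpleFunc B 1 μ)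
  have hs : h =ᵐ[μ] s := (Lp.simpleFunc.toSimpleFunc_eq_toFun ⟨h, hh⟩).symm
  choose l hl hlC using fun b : B => hC b trivial
  let F : α × β → E := fun z => l (s z.1) z.2
  have hF : StronglyMeasurable F := by
    have h1 : F = ∑ b ∈ s.range, ((Prod.fst ⁻¹' (s ⁻¹' {b}) : Set (α × β)).indicator
        fun z => l b z.2) := by
      funext z
      rw [Finset.sum_apply, Finset.sum_eq_single (s z.1), Set.indicator_of_mem (by simp)]
      · intro b _ hb
        exact Set.indicator_of_notMem (by simpa using hb.symm) _
      · intro h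
        exact (h (s.mem_range_self _)).elim
    rw [h1]
    exact Finset.stronglyMeasurable_sum _ fun b _ =>
      ((Lp.stronglyMeasurable (l b)).comp_measurable measurable_snd).indicator
        (measurable_fst (s.measurableSet_preimage _))
  have hsec : ∀ t, sectionLp hE ν hF t = l (s t) := fun t =>
    Lp.ext (coeFn_sectionLp hE ν hF t)
  have hmem := memLp_one_of_norm_le_one (μ := μ.prod ν) hE hF.aestronglyMeasurable
  refine ⟨hmem.toLp F, Lp.ext ?_, ?_⟩
  · filter_upwards [coeFn_fiberMap hE μ q hq (hmem.toLp F) hF hmem.coeFn_toLp, hs] with t h1 h2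
    rw [h1, h2, hsec, hl]
  · rw [Lp.norm_toLp, Lp.norm_def, ← ENNReal.toReal_ofReal hC0, ← ENNReal.toReal_mul]
    refine ENNReal.toReal_mono (ENNReal.mul_ne_top (by simp) (Lp.eLpNorm_ne_top h)) ?_
    rw [eLpNorm_congr_ae hs, eLpNorm_one_eq_lintegral_enorm, eLpNorm_one_eq_lintegral_enorm,
      lintegral_prod _ hF.enorm.aemeasurable, ← lintegral_const_mul _ s.stronglyMeasurable.enorm]
    refine lintegral_mono fun t => ?_
    rw [← enorm_sectionLp hE ν hF t, hsec, ← ofReal_norm, ← ofReal_norm,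
      ← ENNReal.ofReal_mul hC0]
    exact ENNReal.ofReal_le_ofReal (hlC _)

theorem fiberMap_surjectiveOnWith [CompleteSpace E] (hC : ∀ C, 1 < C → q.SurjectiveOnWith ⊤ C)
    {C : ℝ} (h1 : 1 < C) : (fiberMap hE μ q hq).SurjectiveOnWith ⊤ C := by
  -- The slack in `C > 1` is shared: `(1 + C) / 2` for lifting simple functions, `(C - 1) / 2` for
  -- the closure; they add up to `C`.
  have h := controlled_closure_of_complete (C := (1 + C) / 2) (ε := (C - 1) / 2) (by linarith)
    (by linarith) (fiberMap_surjectiveOnWith_simpleFunc hE μ q hq (by linarith) (hC _ (by linarith)))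
  intro b _
  have hb : b ∈ (Lp.simpleFunc B 1 μ).topologicalClosure :=
    Lp.simpleFunc.dense ENNReal.one_ne_top b
  obtain ⟨g, hg, hn⟩ := h b hb
  exact ⟨g, hg, hn.trans_eq (by ring)⟩

end FiberMap

end Curry

/-! ### Alternating sums over cubes. -/

section Cube

variable {Ω : Type v} {Γ : Type u} {n : ℕ}

/-- The vertex of the cube spanned by `p.1` and `p.2` whose coordinates in `S` come from `p.1`. -/
def cubeVertex (S : Finset (Fin n)) (p : (Fin n → Ω) × (Fin n → Ω)) (i : Fin n) : Ω :=
  if i ∈ S then p.1 i else p.2 i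

/-- The alternating sum of `g` over the vertices of the cube spanned by `p.1` and `p.2`. -/
def cubeDiff [AddCommGroup Γ] (g : (Fin n → Ω) → Γ) (p : (Fin n → Ω) × (Fin n → Ω)) : Γ :=
  ∑ S : Finset (Fin n), (-1 : ℤ) ^ S.card • g (cubeVertex S p)

/-- Toggling `i` in `S` is a fixed-point-free involution that flips the sign and leaves the value of
`g` unchanged. -/
theorem cubeDiff_eq_zero_of_indep [AddCommGroup Γ] {g : (Fin n → Ω) → Γ} (i : Fin n)
    (hg : ∀ x y : Fin n → Ω, (∀ j, j ≠ i → x j = y j) → g x = g y)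
    (p : (Fin n → Ω) × (Fin n → Ω)) : cubeDiff g p = 0 := by
  refine Finset.sum_involution (fun S _ => if i ∈ S then S.erase i else insert i S) ?_ ?_ ?_ ?_
  · intro S _
    have h : g (cubeVertex (if i ∈ S then S.erase i else insert i S) p) =
        g (cubeVertex S p) := hg _ _ fun j hj => by
      by_cases hi : i ∈ S <;> simp [cubeVertex, hi, hj]
    rw [h, ← add_smul]
    by_cases hi : i ∈ S
    · rw [if_pos hi, ← Finset.card_erase_add_one hi, pow_succ]
      simp
    · rw [if_neg hi, Finset.card_insert_of_notMem hi, pow_succ]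
      simp
  · intro S _ _ h
    by_cases hi : i ∈ S
    · rw [if_pos hi] at h
      exact Finset.notMem_erase i S (h.symm ▸ hi)
    · rw [if_neg hi] at h
      exact hi (h ▸ Finset.mem_insert_self i S)
  · exact fun _ _ => Finset.mem_univ _
  · intro S _
    by_cases hi : i ∈ S
    · simp [hi, Finset.insert_erase hi]
    · simp [hi, Finset.erase_insert hi]

variable [MeasurableSpace Ω]

theorem measurable_cubeVertex (S : Finset (Fin n)) :
    Measurable (cubeVertex S : (Fin n → Ω) × (Fin n → Ω) → Fin n → Ω) := by
  refine measurable_pi_lambda _ fun i => ?_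
  unfold cubeVertex
  split_ifs <;> fun_prop

variable (μ : Measure Ω) [IsProbabilityMeasure μ]

/-- Each coordinate is drawn from one of two independent copies, so every vertex has the product
law. This makes `cubeDiff` well defined on a.e. classes. -/
theorem measurePreserving_cubeVertex (S : Finset (Fin n)) :
    MeasurePreserving (cubeVertex S)
      ((Measure.pi fun _ : Fin n => μ).prod (Measure.pi fun _ : Fin n => μ))
      (Measure.pi fun _ : Fin n => μ) := by
  have h1 : MeasurePreserving
      (fun (z : Fin n → Ω × Ω) i => (if i ∈ S then Prod.fst else Prod.snd : Ω × Ω → Ω) (z i))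
      (Measure.pi fun _ => μ.prod μ) (Measure.pi fun _ => μ) := by
    refine measurePreserving_pi _ _ fun i => ?_
    split_ifs
    · exact measurePreserving_fst
    · exact measurePreserving_snd
  have h2 := (measurePreserving_arrowProdEquivProdArrow Ω Ω (Fin n) (fun _ => μ)
    fun _ => μ).symm
  convert h1.comp h2 using 1
  funext p i
  simp only [cubeVertex, Function.comp_apply]
  split_ifs <;> rfl

theorem measurePreserving_finCons :
    MeasurePreserving (fun p : Ω × (Fin n → Ω) => (Fin.cons p.1 p.2 : Fin (n + 1) → Ω))
      (μ.prod (Measure.pi fun _ : Fin n => μ)) (Measure.pi fun _ : Fin (n + 1) => μ) := by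
  convert (measurePreserving_piFinSuccAbove (fun _ : Fin (n + 1) => μ) 0).symm using 1
  funext p
  exact (Fin.insertNth_zero' p.1 p.2).symm

theorem measurePreserving_finUncons :
    MeasurePreserving (fun w : Fin (n + 1) → Ω => (w 0, Fin.tail w))
      (Measure.pi fun _ : Fin (n + 1) => μ) (μ.prod (Measure.pi fun _ : Fin n => μ)) := by
  convert measurePreserving_piFinSuccAbove (fun _ : Fin (n + 1) => μ) 0 using 1
  rfl

variable [NormedAddCommGroup Γ]

theorem cubeDiff_ae_congr {f g : (Fin n → Ω) → Γ} (h : f =ᵐ[Measure.pi fun _ : Fin n => μ] g) :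
    cubeDiff f =ᵐ[(Measure.pi fun _ : Fin n => μ).prod (Measure.pi fun _ : Fin n => μ)]
      cubeDiff g := by
  have h' := ae_all_iff.2 fun S : Finset (Fin n) =>
    (measurePreserving_cubeVertex μ S).quasiMeasurePreserving.ae h
  filter_upwards [h'] with p hp
  exact Finset.sum_congr rfl fun S _ => by rw [hp S]

theorem cubeDiff_ae_eq_zero {f : RandomLPow μ Γ n} (hf : f ∈ indepSum μ Γ n) :
    cubeDiff (f : (Fin n → Ω) → Γ)
      =ᵐ[(Measure.pi fun _ : Fin n => μ).prod (Measure.pi fun _ : Fin n => μ)] 0 := by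
  refine AddSubgroup.iSup_induction (indepSubgroup μ Γ n)
    (C := fun f => cubeDiff (f : (Fin n → Ω) → Γ)
      =ᵐ[(Measure.pi fun _ : Fin n => μ).prod (Measure.pi fun _ : Fin n => μ)] 0) hf ?_ ?_ ?_
  · rintro i f ⟨g, -, hg, hfg⟩
    filter_upwards [cubeDiff_ae_congr μ hfg] with p hp
    rw [hp, cubeDiff_eq_zero_of_indep i hg, Pi.zero_apply]
  · filter_upwards [cubeDiff_ae_congr μ (Lp.coeFn_zero Γ 1 (Measure.pi fun _ : Fin n => μ))]
      with p hp
    rw [hp]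
    simp [cubeDiff]
  · intro f g hf hg
    filter_upwards [cubeDiff_ae_congr μ (Lp.coeFn_add f g), hf, hg] with p hp h1 h2
    rw [hp]
    simp only [Pi.zero_apply] at h1 h2 ⊢
    rw [← add_zero (0 : Γ)]
    nth_rw 1 [← h1]
    rw [← h2]
    simp [cubeDiff, Finset.sum_add_distrib]

/-- A map on `Ω × Ωⁿ` whose sections lie in `L_n(Γ)` is a sum of maps that are each independent of
one of the last `n` coordinates. -/
theorem mem_indepSum_of_sectionLp_mem (hΓ : ∀ x : Γ, ‖x‖ ≤ 1) {F : RandomLPow μ Γ (n + 1)}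
    {H : (Fin (n + 1) → Ω) → Γ} (hH : StronglyMeasurable H)
    (hFH : F =ᵐ[Measure.pi fun _ : Fin (n + 1) => μ] H)
    (h : ∀ᵐ t ∂μ, sectionLp hΓ (Measure.pi fun _ : Fin n => μ)
      (hH.comp_measurable (measurePreserving_finCons μ).measurable) t ∈ indepSum μ Γ n) :
    F ∈ indepSum μ Γ (n + 1) := by
  let π := Measure.pi fun _ : Fin n => μ
  have h1 : ∀ᵐ t ∂μ, ∀ᵐ x ∂π, ∀ᵐ y ∂π, cubeDiff (fun x => H (Fin.cons t x)) (x, y) = 0 := by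
    filter_upwards [h] with t ht
    have h2 := (cubeDiff_ae_congr μ (coeFn_sectionLp hΓ π
      (hH.comp_measurable (measurePreserving_finCons μ).measurable) t)).symm.trans
      (cubeDiff_ae_eq_zero μ ht)
    exact Measure.ae_ae_of_ae_prod h2
  have hterm : ∀ S : Finset (Fin n), StronglyMeasurable
      fun p : (Ω × (Fin n → Ω)) × (Fin n → Ω) =>
        (-1 : ℤ) ^ S.card • H (Fin.cons p.1.1 (cubeVertex S (p.1.2, p.2))) := by
    intro S
    have h2 : StronglyMeasurable fun p : (Ω × (Fin n → Ω)) × (Fin n → Ω) =>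
        H (Fin.cons p.1.1 (cubeVertex S (p.1.2, p.2))) :=
      hH.comp_measurable ((measurePreserving_finCons μ).measurable.comp
        (measurable_fst.fst.prodMk ((measurable_cubeVertex S).comp
          (measurable_fst.snd.prodMk measurable_snd))))
    rcases neg_one_pow_eq_or ℤ S.card with h | h
    · simpa [h] using h2
    · simpa [h] using! h2.neg
  have hsum : StronglyMeasurable fun p : (Ω × (Fin n → Ω)) × (Fin n → Ω) =>
      cubeDiff (fun x => H (Fin.cons p.1.1 x)) (p.1.2, p.2) :=
    Finset.stronglyMeasurable_fun_sum _ fun S _ => hterm S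
  have hset : MeasurableSet {p : (Ω × (Fin n → Ω)) × (Fin n → Ω) |
      cubeDiff (fun x => H (Fin.cons p.1.1 x)) (p.1.2, p.2) = 0} :=
    hsum.measurableSet_eq_fun stronglyMeasurable_const
  -- Fubini, based on the joint measurability `hset`: a single `y` works for almost every `(t, x)`.
  obtain ⟨y, hy⟩ : ∃ y, ∀ᵐ p ∂μ.prod π, cubeDiff (fun x => H (Fin.cons p.1 x)) (p.2, y) = 0 := by
    have h2 : ∀ᵐ y ∂π, ∀ᵐ p ∂μ.prod π,
        cubeDiff (fun x => H (Fin.cons p.1 x)) (p.2, y) = 0 := by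
      refine (Measure.ae_ae_comm (p := fun (p : Ω × (Fin n → Ω)) y =>
        cubeDiff (fun x => H (Fin.cons p.1 x)) (p.2, y) = 0) hset).1 ?_
      exact (Measure.ae_prod_iff_ae_ae (measurable_measure_prodMk_left hset.compl
        (measurableSet_singleton 0))).2 h1
    exact h2.exists
  let G : Finset (Fin n) → (Fin (n + 1) → Ω) → Γ := fun S w =>
    (-1 : ℤ) ^ S.card • H (Fin.cons (w 0) (cubeVertex S (Fin.tail w, y)))
  have hG : ∀ S, StronglyMeasurable (G S) := fun S => (hterm S).comp_measurable
    ((measurePreserving_finUncons μ).measurable.prodMk measurable_const)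
  have hGm := fun S => memLp_one_of_norm_le_one (μ := Measure.pi fun _ : Fin (n + 1) => μ) hΓ
    (hG S).aestronglyMeasurable
  have hzero : ∑ S, (hGm S).toLp (G S) = 0 := by
    refine (Lp.eq_zero_iff_ae_eq_zero).2 ?_
    filter_upwards [Lp.coeFn_fun_finsetSum Finset.univ fun S => (hGm S).toLp (G S),
      ae_all_iff.2 fun S => (hGm S).coeFn_toLp,
      (measurePreserving_finUncons μ).quasiMeasurePreserving.ae hy] with w h1 h2 h3
    rw [h1]
    simp only [h2]
    exact h3
  -- If `i ∉ S`, the vertex takes its `i`-th coordinate from the fixed `y`; the shift to `i.succ`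
  -- accounts for the extra coordinate `t`.
  have hmem : ∀ S ≠ Finset.univ, (hGm S).toLp (G S) ∈ indepSum μ Γ (n + 1) := by
    intro S hS
    obtain ⟨i, hi⟩ : ∃ i, i ∉ S := by simpa [Finset.eq_univ_iff_forall] using hS
    refine AddSubgroup.mem_iSup_of_mem i.succ ⟨G S, hG S, ?_, (hGm S).coeFn_toLp⟩
    intro w w' hw
    have h2 : cubeVertex S (Fin.tail w, y) = cubeVertex S (Fin.tail w', y) := by
      funext j
      simp only [cubeVertex]
      split_ifs with hj
      · exact hw _ fun h => hi (Fin.succ_injective _ h ▸ hj)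
      · rfl
    simp only [G, h2, hw 0 (Fin.succ_ne_zero i).symm]
  have huniv : (hGm Finset.univ).toLp (G Finset.univ) ∈ indepSum μ Γ (n + 1) := by
    rw [← Finset.add_sum_erase _ _ (Finset.mem_univ Finset.univ)] at hzero
    rw [eq_neg_of_add_eq_zero_left hzero]
    exact neg_mem (sum_mem fun S hS => hmem S (Finset.ne_of_mem_erase hS))
  -- The full vertex ignores `y`, so this term is `H` up to sign.
  have hHG : G Finset.univ = fun w => (-1 : ℤ) ^ n • H w := by
    funext w
    have : cubeVertex Finset.univ (Fin.tail w, y) = Fin.tail w := by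
      funext j
      simp [cubeVertex]
    simp only [G, this, Fin.cons_self_tail, Finset.card_univ, Fintype.card_fin]
  rcases neg_one_pow_eq_or ℤ n with hn | hn
  · convert huniv
    refine Lp.ext (hFH.trans ((hGm _).coeFn_toLp.trans ?_).symm)
    rw [hHG]
    simp [hn]
  · rw [← neg_mem_iff]
    convert huniv
    refine Lp.ext ((Lp.coeFn_neg F).trans (hFH.neg.trans ((hGm _).coeFn_toLp.trans ?_).symm))
    rw [hHG]
    simp only [hn, neg_smul, one_smul]
    rfl

end Cube

/-! ### Metric quotient maps. -/

section MetricQuotient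

/-- `q` is surjective and the norm of its codomain is the quotient norm. -/
structure IsMetricQuotient {A B : Type*} [NormedAddCommGroup A] [NormedAddCommGroup B]
    (q : NormedAddGroupHom A B) : Prop where
  norm_le : ∀ a, ‖q a‖ ≤ ‖a‖
  surjectiveOnWith : ∀ C, 1 < C → q.SurjectiveOnWith ⊤ C

variable {A B : Type*} [NormedAddCommGroup A] [NormedAddCommGroup B]

theorem IsMetricQuotient.comp {D : Type*} [NormedAddCommGroup D] {p : NormedAddGroupHom B D}
    {q : NormedAddGroupHom A B} (hp : IsMetricQuotient p) (hq : IsMetricQuotient q) :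
    IsMetricQuotient (p.comp q) where
  norm_le a := (hp.norm_le _).trans (hq.norm_le a)
  surjectiveOnWith C hC d _ := by
    have hC0 : 0 ≤ C := by linarith
    -- Each of the two lifts may lose a factor `√C`.
    have hs : 1 < √C := by rwa [Real.lt_sqrt zero_le_one, one_pow]
    obtain ⟨b, rfl, hb⟩ := hp.surjectiveOnWith _ hs d trivial
    obtain ⟨a, rfl, ha⟩ := hq.surjectiveOnWith _ hs b trivial
    refine ⟨a, rfl, ha.trans ?_⟩
    calc √C * ‖q a‖ ≤ √C * (√C * ‖p (q a)‖) := by gcongr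
      _ = C * ‖p (q a)‖ := by rw [← mul_assoc, Real.mul_self_sqrt hC0]

theorem isMetricQuotient_normedMk (S : AddSubgroup A) [hS : IsClosed (S : Set A)] :
    IsMetricQuotient (S.normedMk : NormedAddGroupHom A (A ⧸ S)) where
  norm_le a := QuotientAddGroup.norm_mk_le_norm
  surjectiveOnWith C hC x _ := by
    rcases eq_or_ne x 0 with rfl | hx
    · exact ⟨0, map_zero _, by simp⟩
    · have h : 0 < (C - 1) * ‖x‖ := mul_pos (by linarith) (norm_pos_iff.2 hx)
      obtain ⟨m, hm, hlt⟩ := QuotientAddGroup.exists_norm_mk_lt x h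
      exact ⟨m, hm, hlt.le.trans_eq (by ring)⟩

theorem IsMetricQuotient.exists_isometry {q : NormedAddGroupHom A B} (hq : IsMetricQuotient q) :
    ∃ e : B ≃+ A ⧸ q.ker, Isometry e := by
  have hsurj : Function.Surjective q.toAddMonoidHom := fun b =>
    let ⟨a, ha, _⟩ := hq.surjectiveOnWith 2 one_lt_two b trivial
    ⟨a, ha⟩
  let e := (QuotientAddGroup.quotientKerEquivOfSurjective q.toAddMonoidHom hsurj).symm
  have he : ∀ a, e (q a) = (a : A ⧸ q.ker) := fun a => by
    exact (AddEquiv.symm_apply_eq _).2 rfl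
  refine ⟨e, AddMonoidHomClass.isometry_of_norm e fun b => le_antisymm ?_ ?_⟩
  · refine le_of_forall_pos_le_add fun ε hε => ?_
    -- This constant turns the multiplicative loss into an additive error of at most `ε`; the `+ 1`
    -- covers `b = 0`.
    obtain ⟨a, rfl, ha⟩ := hq.surjectiveOnWith (1 + ε / (‖b‖ + 1))
      (lt_add_of_pos_right _ (by positivity)) b trivial
    have h1 : ε / (‖q a‖ + 1) * ‖q a‖ ≤ ε := by
      rw [div_mul_eq_mul_div, div_le_iff₀ (by positivity)]
      nlinarith
    calc ‖e (q a)‖ = ‖(a : A ⧸ q.ker)‖ := congrArg _ (he a)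
      _ ≤ ‖a‖ := QuotientAddGroup.norm_mk_le_norm
      _ ≤ ‖q a‖ + ε := by linarith
  · refine le_of_forall_pos_lt_add fun ε hε => ?_
    obtain ⟨m, hm, hlt⟩ := QuotientAddGroup.exists_norm_mk_lt (e b) hε
    obtain rfl : q m = b := e.injective ((he m).trans hm)
    exact (hq.norm_le m).trans_lt hlt

end MetricQuotient

/-! ### The inductive step and its kernel. -/

section Iterate

variable {Ω : Type v} [MeasurableSpace Ω] (μ : Measure Ω) [IsProbabilityMeasure μ]
variable {Γ : Type u} [NormedAddCommGroup Γ]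

/-- Precomposition with `(t, x) ↦ (t, x₁, …, xₙ)`. -/
noncomputable def uncons (Γ : Type u) [NormedAddCommGroup Γ] (n : ℕ) :
    NormedAddGroupHom (RandomLPow μ Γ (n + 1)) (Lp Γ 1 (μ.prod (Measure.pi fun _ : Fin n => μ))) :=
  AddMonoidHom.mkNormedAddGroupHom (Lp.compMeasurePreserving _ (measurePreserving_finCons μ)) 1
    fun f => by rw [Lp.norm_compMeasurePreserving, one_mul]

theorem isMetricQuotient_uncons (n : ℕ) : IsMetricQuotient (uncons μ Γ n) where
  norm_le f := (Lp.norm_compMeasurePreserving f (measurePreserving_finCons μ)).le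
  surjectiveOnWith C hC f _ := by
    refine ⟨Lp.compMeasurePreserving _ (measurePreserving_finUncons μ) f, ?_, ?_⟩
    · have h := Lp.compMeasurePreserving_comp_apply f (measurePreserving_finUncons (n := n) μ)
        (measurePreserving_finCons μ)
      exact h.symm.trans (Lp.compMeasurePreserving_id_apply f)
    · rw [Lp.norm_compMeasurePreserving]
      exact le_mul_of_one_le_left (norm_nonneg f) hC.le

/-- Allowing an arbitrary representative `H` makes it possible to use one that is independent of a
coordinate everywhere, not just almost everywhere. -/
theorem mem_ker_normedMk_comp_fiberMap_iff {n : ℕ} {B : Type*} [NormedAddCommGroup B]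
    (hΓ : ∀ x : Γ, ‖x‖ ≤ 1)
    {q : NormedAddGroupHom (RandomLPow μ Γ n) B} (hq : ∀ f, ‖q f‖ ≤ ‖f‖)
    (F : RandomLPow μ Γ (n + 1)) {H : (Fin (n + 1) → Ω) → Γ} (hH : StronglyMeasurable H)
    (hFH : F =ᵐ[Measure.pi fun _ : Fin (n + 1) => μ] H) :
    F ∈ ((constSubgroup μ B).normedMk.comp ((fiberMap hΓ μ q hq).comp (uncons μ Γ n))).ker ↔
      ∃ b, ∀ᵐ t ∂μ, q (sectionLp hΓ (Measure.pi fun _ : Fin n => μ)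
        (hH.comp_measurable (measurePreserving_finCons μ).measurable) t) = b := by
  have h1 := coeFn_fiberMap hΓ μ q hq (uncons μ Γ n F)
    (hH.comp_measurable (measurePreserving_finCons μ).measurable)
    ((Lp.coeFn_compMeasurePreserving F (measurePreserving_finCons μ)).trans
      ((measurePreserving_finCons μ).quasiMeasurePreserving.ae_eq_comp hFH))
  rw [NormedAddGroupHom.mem_ker]
  refine (QuotientAddGroup.eq_zero_iff _).trans (exists_congr fun b => ?_)
  have h2 := Lp.coeFn_const 1 μ b
  constructor
  · intro h
    filter_upwards [h1, h2] with t h1 h2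
    rw [← h1]
    exact (congrArg (fun g : Lp B 1 μ => (g : Ω → B) t) h.symm).trans h2
  · intro h
    refine Lp.ext ?_
    filter_upwards [h1, h2, h] with t h1 h2 h
    exact h2.trans (h.symm.trans h1.symm)

theorem ker_normedMk_comp_fiberMap {n : ℕ} {B : Type*} [NormedAddCommGroup B]
    (hΓ : ∀ x : Γ, ‖x‖ ≤ 1)
    {q : NormedAddGroupHom (RandomLPow μ Γ n) B} (hq : IsMetricQuotient q)
    (hker : q.ker = indepSum μ Γ n) :
    ((constSubgroup μ B).normedMk.comp ((fiberMap hΓ μ q hq.norm_le).comp (uncons μ Γ n))).ker =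
      indepSum μ Γ (n + 1) := by
  have hcons := (measurePreserving_finCons (n := n) μ).measurable
  refine le_antisymm (fun F hF => ?_) (iSup_le fun i F hF => ?_)
  · obtain ⟨b, hb⟩ := (mem_ker_normedMk_comp_fiberMap_iff μ hΓ hq.norm_le F (Lp.stronglyMeasurable F)
      EventuallyEq.rfl).1 hF
    obtain ⟨f, rfl, -⟩ := hq.surjectiveOnWith 2 one_lt_two b trivial
    have htail : MeasurePreserving (Fin.tail : (Fin (n + 1) → Ω) → Fin n → Ω)
        (Measure.pi fun _ => μ) (Measure.pi fun _ => μ) :=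
      measurePreserving_snd.comp (measurePreserving_finUncons μ)
    have hsm := (Lp.stronglyMeasurable f).comp_measurable htail.measurable
    have hf := Lp.coeFn_compMeasurePreserving f htail
    -- The lift `f` of `b`, read as a function of the last `n` coordinates, is independent of
    -- coordinate `0`.
    have h0 : Lp.compMeasurePreserving _ htail f ∈ indepSum μ Γ (n + 1) :=
      AddSubgroup.mem_iSup_of_mem 0 ⟨_, hsm, fun x y h => congrArg f (funext fun j =>
        h j.succ (Fin.succ_ne_zero j)), hf⟩
    rw [← sub_add_cancel F (Lp.compMeasurePreserving _ htail f)]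
    refine add_mem (mem_indepSum_of_sectionLp_mem μ hΓ ((Lp.stronglyMeasurable F).sub hsm)
      ((Lp.coeFn_sub _ _).trans (EventuallyEq.rfl.sub hf)) ?_) h0
    filter_upwards [hb] with t ht
    rw [← hker, NormedAddGroupHom.mem_ker]
    have h1 : sectionLp hΓ (Measure.pi fun _ : Fin n => μ) (hsm.comp_measurable hcons) t = f :=
      Lp.ext (coeFn_sectionLp hΓ _ _ t)
    refine (congrArg q (congrFun (sectionLp_sub hΓ _
      ((Lp.stronglyMeasurable F).comp_measurable hcons) (hsm.comp_measurable hcons)) t)).trans ?_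
    rw [Pi.sub_apply, map_sub, ht, h1, sub_self]
  · obtain ⟨g, hg, hi, hFg⟩ := hF
    refine (mem_ker_normedMk_comp_fiberMap_iff μ hΓ hq.norm_le F hg hFg).2 ?_
    -- Independence of coordinate `0` makes all sections equal; independence of `i.succ` puts every
    -- section in `L_{i,n}`, which `q` kills.
    induction i using Fin.cases with
    | zero =>
      obtain ⟨t₀⟩ : Nonempty Ω := nonempty_of_isProbabilityMeasure μ
      refine ⟨q (sectionLp hΓ _ (hg.comp_measurable hcons) t₀), Eventually.of_forall fun t => ?_⟩
      congr 1
      refine MemLp.toLp_congr _ _ (Eventually.of_forall fun x => hi _ _ fun j hj => ?_)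
      obtain ⟨k, rfl⟩ := Fin.exists_succ_eq.2 hj
      rfl
    | succ i =>
      refine ⟨0, Eventually.of_forall fun t => ?_⟩
      rw [← NormedAddGroupHom.mem_ker, hker]
      refine AddSubgroup.mem_iSup_of_mem i ⟨_, (hg.comp_measurable hcons).comp_measurable
        measurable_prodMk_left, fun x y h => hi _ _ fun j hj => ?_, coeFn_sectionLp hΓ _ _ t⟩
      induction j using Fin.cases with
      | zero => rfl
      | succ j => exact h j fun hji => hj (hji ▸ rfl)

theorem exists_isMetricQuotient_classifyingQuotient [CompleteSpace Γ] {n : ℕ}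
    {B : Type*} [NormedAddCommGroup B]
    (hΓ : ∀ x : Γ, ‖x‖ ≤ 1)
    (h : ∃ q : NormedAddGroupHom (RandomLPow μ Γ n) B,
      IsMetricQuotient q ∧ q.ker = indepSum μ Γ n) :
    ∃ q : NormedAddGroupHom (RandomLPow μ Γ (n + 1)) (ClassifyingQuotient μ B),
      IsMetricQuotient q ∧ q.ker = indepSum μ Γ (n + 1) := by
  obtain ⟨q, hq, hker⟩ := h
  have hfib : IsMetricQuotient (fiberMap hΓ μ q hq.norm_le) :=
    ⟨norm_fiberMap_le hΓ μ q hq.norm_le, fun C hC =>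
      fiberMap_surjectiveOnWith hΓ μ q hq.norm_le hq.surjectiveOnWith hC⟩
  exact ⟨_, (isMetricQuotient_normedMk _).comp (hfib.comp (isMetricQuotient_uncons μ n)),
    ker_normedMk_comp_fiberMap μ hΓ hq hker⟩

/-- `L(Ω⁰, Γ) = Γ`. -/
theorem exists_isMetricQuotient_zero (Γ : Type u) [NormedAddCommGroup Γ] :
    ∃ q : NormedAddGroupHom (RandomLPow μ Γ 0) Γ,
      IsMetricQuotient q ∧ q.ker = indepSum μ Γ 0 := by
  -- `Ω⁰` is a single point of mass 1, so evaluation there is well defined on classes.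
  have hae : ∀ {p : (Fin 0 → Ω) → Prop}, (∀ᵐ x ∂Measure.pi fun _ : Fin 0 => μ, p x) →
      p default := fun h => by
    obtain ⟨x, hx⟩ := h.exists
    rwa [Subsingleton.elim default x]
  have hconst : ∀ f : RandomLPow μ Γ 0, Lp.const 1 _ (f default) = f := fun f =>
    Lp.ext <| (Lp.coeFn_const 1 _ _).trans <| Eventually.of_forall fun x => by
      rw [Subsingleton.elim x default]
      rfl
  have hnorm : ∀ f : RandomLPow μ Γ 0, ‖f default‖ = ‖f‖ := fun f => by
    have h := Lp.norm_const' 1 (Measure.pi fun _ : Fin 0 => μ) (f default) one_ne_zero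
      ENNReal.one_ne_top
    rw [hconst f] at h
    simpa using h.symm
  let q : NormedAddGroupHom (RandomLPow μ Γ 0) Γ := AddMonoidHom.mkNormedAddGroupHom
    (AddMonoidHom.mk' (fun f => f default) fun f g => hae (Lp.coeFn_add f g)) 1
    fun f => by simpa using (hnorm f).le
  refine ⟨q, ⟨fun f => (hnorm f).le, fun C hC c _ => ?_⟩, ?_⟩
  · refine ⟨Lp.const 1 _ c, hae (Lp.coeFn_const 1 _ c), ?_⟩
    rw [← hnorm, hae (Lp.coeFn_const 1 _ c)]
    exact le_mul_of_one_le_left (norm_nonneg c) hC.le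
  · rw [indepSum, iSup_of_empty, eq_bot_iff]
    intro f hf
    rw [NormedAddGroupHom.mem_ker] at hf
    rw [AddSubgroup.mem_bot, ← norm_eq_zero, ← hnorm f]
    exact norm_eq_zero.2 hf

/-- The case `B_1` is already an instance of the inductive step, applied to `L(Ω⁰, Γ) → Γ`; this
uses `Γ` itself and bypasses the `ULift` in `iteratedB μ Γ 0`. -/
theorem exists_isMetricQuotient_iteratedB [CompleteSpace Γ] (hΓ : ∀ x : Γ, ‖x‖ ≤ 1) (n : ℕ) :
    ∃ q : NormedAddGroupHom (RandomLPow μ Γ (n + 1)) (iteratedB μ Γ (n + 1)).carrier,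
      IsMetricQuotient q ∧ q.ker = indepSum μ Γ (n + 1) := by
  induction n with
  | zero => exact exists_isMetricQuotient_classifyingQuotient μ hΓ (exists_isMetricQuotient_zero μ Γ)
  | succ n ih => exact exists_isMetricQuotient_classifyingQuotient μ hΓ ih

end Iterate

theorem mainTheorem11 {Ω : Type v} [MeasurableSpace Ω] [StandardBorelSpace Ω]
    (μ : Measure Ω) [IsProbabilityMeasure μ] [NullSingletonClass μ]
    (Γ : Type u) [NormedAddCommGroup Γ] (hΓ : ∀ x y : Γ, x ≠ y → dist x y = 1)
    (n : ℕ) (hn : 1 ≤ n) :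
    IsClosed (indepSum μ Γ n : Set (RandomLPow μ Γ n)) ∧
    ∃ e : (iteratedB μ Γ n).carrier ≃+ RandomLPow μ Γ n ⧸ indepSum μ Γ n, Isometry e := by
  have hle : ∀ x : Γ, ‖x‖ ≤ 1 := fun x => by
    rcases eq_or_ne x 0 with rfl | hx
    · simp
    · rw [← dist_zero_right, hΓ x 0 hx]
  have : CompleteSpace Γ := by
    have : DiscreteUniformity Γ :=
      ⟨Metric.uniformSpace_eq_bot.2 ⟨1, one_pos, fun x y h => (hΓ x y h).ge⟩⟩
    infer_instance
  obtain ⟨n, rfl⟩ := Nat.exists_eq_add_of_le' hn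
  obtain ⟨q, hq, hker⟩ := exists_isMetricQuotient_iteratedB μ hle n
  rw [← hker]
  exact ⟨q.isClosed_ker, hq.exists_isometry⟩
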